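/- Bimodal formulas are built from a countably infinite set of propositional variables by $\psi ::= p \mid \bot \mid \psi\to\psi \mid \square\psi \mid [\neq]\psi$, with $\neg,\wedge,\vee$ defined as usual from $\to,\bot$, and with $\langle\neq\rangle A=\neg[\neq]\neg A$ and $[\forall]A=[\neq]A\wedge A$. A normal bimodal logic is a set of formulas that contains all classical tautologies, $\square(p\to q)\to(\square p\to\square q)$ and $[\neq](p\to q)\to([\neq]p\to[\neq]q)$, and that is closed under modus ponens, necessitation for $\square$ and for $[\neq]$, and substitution of a formula for a variable. Let $\mathbf{S4D}$ be the least normal bimodal logic containing $$\square p\to p,\quad \square p\to\square\square p,\quad [\forall]p\to\square p,\quad p\to[\neq]\langle\neq\rangle p,\quad [\forall]p\to[\neq][\neq]p,$$ and let $\mathbf{S4DT_0}$ be the least normal bimodal logic containing $\mathbf{S4D}$ and the formula $$(p\wedge[\neq]\neg p\wedge\langle\neq\rangle(q\wedge[\neq]\neg q))\to(\square\neg q\vee\langle\neq\rangle(q\wedge\square\neg p)).\qquad (AT_0)$$ In a topological space $X$ with a valuation $V$ assigning a subset of $X$ to each variable, $p$ is true at $x$ iff $x\in V(p)$; $\bot$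 is true nowhere; $\phi\to\psi$ is true at $x$ iff $\phi$ is not true at $x$ or $\psi$ is true at $x$; $\square\phi$ is true at $x$ iff $\phi$ is true at all points of some open set containing $x$; and $[\neq]\phi$ is true at $x$ iff $\phi$ is true at every $y\neq x$. A formula is valid in $X$ if it is true at every point of $X$ under every valuation. **Theorem 7.2.** The logic $\mathbf{S4DT_0}$ is complete with respect to topological $T_0$-spaces: a formula belongs to $\mathbf{S4DT_0}$ if and only if it is valid in every $T_0$-space. -/

import Mathlib

/-- Bimodal formulas `ψ ::= p | ⊥ | ψ → ψ | □ψ | [≠]ψ` over the countably infinite set `ℕ` of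
propositional variables. -/
inductive BiForm : Type where
  | var (p : ℕ) : BiForm
  | bot : BiForm
  | imp (A B : BiForm) : BiForm
  | box (A : BiForm) : BiForm
  | nbox (A : BiForm) : BiForm

namespace BiForm

/-- Negation. -/
def neg (A : BiForm) : BiForm := imp A bot

/-- Conjunction. -/
def conj (A B : BiForm) : BiForm := neg (imp A (neg B))

/-- Disjunction. -/
def disj (A B : BiForm) : BiForm := imp (neg A) B

/-- The dual `⟨≠⟩A = ¬[≠]¬A`. -/
def ndia (A : BiForm) : BiForm := neg (nbox (neg A))

/-- `[∀]A = [≠]A ∧ A`. -/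
def all (A : BiForm) : BiForm := conj (nbox A) A

/-- `A.subst p B` is `[B/p]A`: every occurrence of the variable `p` in `A` is replaced by `B`. -/
def subst (p : ℕ) (B : BiForm) : BiForm → BiForm
  | var q => if q = p then B else var q
  | bot => bot
  | imp A C => imp (subst p B A) (subst p B C)
  | box A => box (subst p B A)
  | nbox A => nbox (subst p B A)

/-- Classical tautologies of the bimodal language: formulas true under every truth assignment
that respects `⊥` and `→` (formulas `□A` and `[≠]A` are treated like atoms). -/
def IsTautology (A : BiForm) : Prop :=
  ∀ v : BiForm → Prop, ¬ v bot → (∀ B C, v (imp B C) ↔ (v B → v C)) → v A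

/-- Normal bimodal logics. -/
structure IsNormalLogic (L : Set BiForm) : Prop where
  taut : ∀ A, IsTautology A → A ∈ L
  norm_box : imp (box (imp (var 0) (var 1))) (imp (box (var 0)) (box (var 1))) ∈ L
  norm_nbox : imp (nbox (imp (var 0) (var 1))) (imp (nbox (var 0)) (nbox (var 1))) ∈ L
  mp : ∀ A B, imp A B ∈ L → A ∈ L → B ∈ L
  nec_box : ∀ A, A ∈ L → box A ∈ L
  nec_nbox : ∀ A, A ∈ L → nbox A ∈ L
  sub : ∀ A B p, A ∈ L → subst p B A ∈ L

/-- The minimal normal bimodal logic containing a set of formulas. -/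
def minLogic (Γ : Set BiForm) : Set BiForm :=
  ⋂₀ {L | IsNormalLogic L ∧ Γ ⊆ L}

theorem minLogic_isLeast (Γ : Set BiForm) :
    IsLeast {L | IsNormalLogic L ∧ Γ ⊆ L} (minLogic Γ) := by
  refine ⟨⟨⟨?_, ?_, ?_, ?_, ?_, ?_, ?_⟩, fun A hA L hL => hL.2 hA⟩, fun L hL A hA => hA L hL⟩
  · exact fun A hA L hL => hL.1.taut A hA
  · exact fun L hL => hL.1.norm_box
  · exact fun L hL => hL.1.norm_nbox
  · exact fun A B hAB hA L hL => hL.1.mp A B (hAB L hL) (hA L hL)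
  · exact fun A hA L hL => hL.1.nec_box A (hA L hL)
  · exact fun A hA L hL => hL.1.nec_nbox A (hA L hL)
  · exact fun A B p hA L hL => hL.1.sub A B p (hA L hL)

/-- `L + Γ`, the minimal normal bimodal logic containing `L ∪ Γ`. -/
def plus (L Γ : Set BiForm) : Set BiForm := minLogic (L ∪ Γ)

/-- `□p → p`. -/
def axT : BiForm := imp (box (var 0)) (var 0)

/-- `□p → □□p`. -/
def axFour : BiForm := imp (box (var 0)) (box (box (var 0)))

/-- `[∀]p → □p`. -/
def axD : BiForm := imp (all (var 0)) (box (var 0))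

/-- `p → [≠]⟨≠⟩p`. -/
def axBD : BiForm := imp (var 0) (nbox (ndia (var 0)))

/-- `[∀]p → [≠][≠]p`. -/
def axFourD : BiForm := imp (all (var 0)) (nbox (nbox (var 0)))

/-- `(p ∧ [≠]¬p ∧ ⟨≠⟩(q ∧ [≠]¬q)) → (□¬q ∨ ⟨≠⟩(q ∧ □¬p))`. -/
def axT0 : BiForm :=
  imp
    (conj (conj (var 0) (nbox (neg (var 0))))
      (ndia (conj (var 1) (nbox (neg (var 1))))))
    (disj (box (neg (var 1)))
      (ndia (conj (var 1) (box (neg (var 0))))))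

/-- The minimal normal bimodal logic `K₂`. -/
def K2 : Set BiForm := minLogic ∅

/-- The logic `S4D`. -/
def S4D : Set BiForm := plus K2 {axT, axFour, axD, axBD, axFourD}

/-- The logic `S4DT₀ = S4D + AT₀`. -/
def S4DT0 : Set BiForm := plus S4D {axT0}

/-- Truth at a point of a topological space under the valuation `V`. -/
def Holds {X : Type*} [TopologicalSpace X] (V : ℕ → Set X) : BiForm → X → Prop
  | var p, x => x ∈ V p
  | bot, _ => False
  | imp A B, x => Holds V A x → Holds V B x
  | box A, x => ∃ U : Set X, IsOpen U ∧ x ∈ U ∧ ∀ y ∈ U, Holds V A y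
  | nbox A, x => ∀ y, y ≠ x → Holds V A y

/-- Validity of a formula in a topological space. -/
def ValidIn (X : Type*) [TopologicalSpace X] (A : BiForm) : Prop :=
  ∀ (V : ℕ → Set X) (x : X), Holds V A x

/-- The logic of a class of topological spaces. -/
def logicOf (C : Set TopCat) : Set BiForm := {A | ∀ X ∈ C, ValidIn X A}

/-- A logic `L` is complete with respect to a class `C` of spaces if the logic of `C` equals `L`. -/
def IsCompleteFor (L : Set BiForm) (C : Set TopCat) : Prop := logicOf C = L

end BiForm

universe u

namespace BiForm

/-! ### Soundness -/

/-! Soundness is routine except for `axT0`, where `p` and `q` name two distinct points and a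
separating open set contains one of them.

Completeness starts from the canonical frame. There `Rel` is a preorder, and inside one `component`
any two distinct worlds are `NRel`-related, so `NRel` differs from inequality only at the worlds
related to themselves. Replacing each such world by infinitely many copies turns `NRel` into true
inequality (`exists_ne_world_eq_iff`). An up-set topology would leave copies of one world
inseparable, so open sets need only contain cofinitely many copies of an accessible duplicated
world. Duplicated points are then closed, while every neighbourhood still meets each accessible
world (`exists_mem_world_eq`), which gives the truth lemma `holds_valuation`. Two unduplicated
points are separated by `Rel`-cones: their worlds have names, and `axT0` applied to the names
forbids `Rel` both ways (`not_rel_and_rel`). -/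

theorem holds_subst {X : Type*} [TopologicalSpace X] (V : ℕ → Set X) (p : ℕ) (B : BiForm)
    (A : BiForm) (x : X) :
    Holds V (subst p B A) x ↔ Holds (Function.update V p {y | Holds V B y}) A x := by
  induction A generalizing x with
  | var q =>
    by_cases h : q = p
    · subst h; simp [subst, Holds]
    · simp [subst, Holds, h]
  | bot => rfl
  | imp A C hA hC => simp only [subst, Holds, hA, hC]
  | box A hA => simp only [subst, Holds, hA]
  | nbox A hA => simp only [subst, Holds, hA]

theorem isNormalLogic_logicOf (C : Set TopCat.{u}) : IsNormalLogic (logicOf C) where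
  taut A hA X _ V x := hA (fun B => Holds V B x) id (fun _ _ => Iff.rfl)
  norm_box := by
    rintro X - V x ⟨U, hU, hxU, h⟩ ⟨U', hU', hxU', h'⟩
    exact ⟨U ∩ U', hU.inter hU', ⟨hxU, hxU'⟩, fun y hy => h y hy.1 (h' y hy.2)⟩
  norm_nbox X _ V x h h' y hy := h y hy (h' y hy)
  mp A B hAB hA X hX V x := hAB X hX V x (hA X hX V x)
  nec_box A hA X hX V x := ⟨Set.univ, isOpen_univ, trivial, fun y _ => hA X hX V y⟩
  nec_nbox A hA X hX V x y _ := hA X hX V y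
  sub A B p hA X hX V x := (holds_subst V p B A x).2 (hA X hX _ x)

theorem minLogic_subset {Γ L : Set BiForm} (hL : IsNormalLogic L) (h : Γ ⊆ L) : minLogic Γ ⊆ L :=
  (minLogic_isLeast Γ).2 ⟨hL, h⟩

theorem axT0_valid (X : Type*) [TopologicalSpace X] [T0Space X] : ValidIn X axT0 := by
  intro V x
  simp only [axT0, conj, disj, neg, ndia, Holds, imp_false, not_not, Classical.not_imp,
    not_forall, not_exists]
  rintro ⟨⟨hp, hp'⟩, y, hyx, hq, hq'⟩ hbox
  refine ⟨y, hyx, hq, ?_⟩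
  obtain ⟨U, hU, hxy⟩ := exists_isOpen_xor_mem hyx
  rcases hxy with ⟨hy, hx⟩ | ⟨hx, hy⟩
  -- An open set around `y` missing `x` yields `□¬p` at `y`, as `p` holds only at `x`; one around
  -- `x` missing `y` would yield `□¬q` at `x`.
  · refine ⟨U, hU, hy, fun z hz hzp => hp' z ⟨?_, hzp⟩⟩
    rintro rfl
    exact hx hz
  · refine absurd ⟨hU, hx, fun z hz hzq => hq' z ⟨?_, hzq⟩⟩ (hbox U)
    rintro rfl
    exact hy hz

theorem S4DT0_subset_logicOf : S4DT0 ⊆ logicOf {X : TopCat.{u} | T0Space X} := by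
  have hN := isNormalLogic_logicOf {X : TopCat.{u} | T0Space X}
  refine minLogic_subset hN (Set.union_subset (minLogic_subset hN (Set.union_subset
    (minLogic_subset hN (Set.empty_subset _)) ?_)) ?_)
  · rintro A (rfl | rfl | rfl | rfl | rfl)
    · rintro X - V x ⟨U, -, hx, h⟩
      exact h x hx
    · rintro X - V x ⟨U, hU, hx, h⟩
      exact ⟨U, hU, hx, fun y hy => ⟨U, hU, hy, h⟩⟩
    · intro X _ V x
      simp only [axD, all, conj, neg, Holds, imp_false, Classical.not_imp, not_not]
      rintro ⟨h, hx⟩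
      refine ⟨Set.univ, isOpen_univ, trivial, fun y _ => ?_⟩
      by_cases hy : y = x
      · exact hy ▸ hx
      · exact h y hy
    · intro X _ V x hx y hy h
      exact h x hy.symm hx
    · intro X _ V x
      simp only [axFourD, all, conj, neg, Holds, imp_false, Classical.not_imp, not_not]
      rintro ⟨h, hx⟩ y - z -
      by_cases hz : z = x
      · exact hz ▸ hx
      · exact h z hz
  · rintro A rfl X hX
    have : T0Space X := hX
    exact axT0_valid X

/-! ### Substitution instances of axioms in two variables -/

theorem exists_forall_subst_eq (A : BiForm) : ∃ n, ∀ k, n ≤ k → ∀ B, subst k B A = A := by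
  induction A with
  | var q =>
    refine ⟨q + 1, fun k hk B => ?_⟩
    simp only [subst, if_neg (show q ≠ k by omega)]
  | bot => exact ⟨0, fun _ _ _ => rfl⟩
  | imp A C hA hC =>
    obtain ⟨n, hn⟩ := hA
    obtain ⟨m, hm⟩ := hC
    exact ⟨max n m, fun k hk B => by
      simp only [subst, hn k (le_of_max_le_left hk), hm k (le_of_max_le_right hk)]⟩
  | box A hA => exact hA.imp fun n hn k hk B => by simp only [subst, hn k hk]
  | nbox A hA => exact hA.imp fun n hn k hk B => by simp only [subst, hn k hk]

theorem exists_fresh (A : BiForm) : ∃ k, 2 ≤ k ∧ ∀ B, subst k B A = A := by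
  obtain ⟨n, hn⟩ := exists_forall_subst_eq A
  exact ⟨max 2 n, le_max_left _ _, hn _ (le_max_right _ _)⟩

namespace IsNormalLogic

variable {L : Set BiForm}

/-- Simultaneous substitution out of single ones: variable 1 is first renamed to a `k` fresh for
`A`, so that the final replacement of `k` by `B` leaves the inserted copies of `A` intact. -/
theorem sub₂ (hL : IsNormalLogic L) {F : BiForm} (hF : F ∈ L) (A B : BiForm) :
    ∃ k, 2 ≤ k ∧ (∀ C, subst k C A = A) ∧ subst k B (subst 0 A (subst 1 (var k) F)) ∈ L := by
  obtain ⟨k, hk, hkA⟩ := exists_fresh A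
  exact ⟨k, hk, hkA, hL.sub _ _ _ (hL.sub _ _ _ (hL.sub _ _ _ hF))⟩

theorem box_imp (hL : IsNormalLogic L) (A B : BiForm) :
    imp (box (imp A B)) (imp (box A) (box B)) ∈ L := by
  obtain ⟨k, hk, hkA, h⟩ := hL.sub₂ hL.norm_box A B
  simpa [subst, hkA, show k ≠ 0 by omega] using h

theorem nbox_imp (hL : IsNormalLogic L) (A B : BiForm) :
    imp (nbox (imp A B)) (imp (nbox A) (nbox B)) ∈ L := by
  obtain ⟨k, hk, hkA, h⟩ := hL.sub₂ hL.norm_nbox A B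
  simpa [subst, hkA, show k ≠ 0 by omega] using h

end IsNormalLogic

theorem isNormalLogic_S4DT0 : IsNormalLogic S4DT0 := (minLogic_isLeast _).1.1

theorem axT0_inst (A B : BiForm) :
    imp (conj (conj A (nbox (neg A))) (ndia (conj B (nbox (neg B)))))
      (disj (box (neg B)) (ndia (conj B (box (neg A))))) ∈ S4DT0 := by
  have h0 : axT0 ∈ S4DT0 := (minLogic_isLeast _).1.2 (Or.inr rfl)
  obtain ⟨k, hk, hkA, h⟩ := isNormalLogic_S4DT0.sub₂ h0 A B
  simpa [axT0, conj, disj, neg, ndia, subst, hkA, show k ≠ 0 by omega] using h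

theorem mem_S4DT0_of_axiom {F : BiForm}
    (hF : F ∈ ({axT, axFour, axD, axBD, axFourD} : Set BiForm)) : F ∈ S4DT0 :=
  (minLogic_isLeast _).1.2 (Or.inl ((minLogic_isLeast _).1.2 (Or.inr hF)))

theorem axT_inst (A : BiForm) : imp (box A) A ∈ S4DT0 :=
  isNormalLogic_S4DT0.sub axT A 0 (mem_S4DT0_of_axiom (by simp))

theorem axFour_inst (A : BiForm) : imp (box A) (box (box A)) ∈ S4DT0 :=
  isNormalLogic_S4DT0.sub axFour A 0 (mem_S4DT0_of_axiom (by simp))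

theorem axD_inst (A : BiForm) : imp (all A) (box A) ∈ S4DT0 :=
  isNormalLogic_S4DT0.sub axD A 0 (mem_S4DT0_of_axiom (by simp))

theorem axBD_inst (A : BiForm) : imp A (nbox (ndia A)) ∈ S4DT0 :=
  isNormalLogic_S4DT0.sub axBD A 0 (mem_S4DT0_of_axiom (by simp))

theorem axFourD_inst (A : BiForm) : imp (all A) (nbox (nbox A)) ∈ S4DT0 :=
  isNormalLogic_S4DT0.sub axFourD A 0 (mem_S4DT0_of_axiom (by simp))

/-! ### Theories and maximal theories -/

/-- A theory over `L`: a set of formulas containing `L` and closed under modus ponens. -/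
structure IsTheory (L T : Set BiForm) : Prop where
  subset : L ⊆ T
  mp : ∀ A B, imp A B ∈ T → A ∈ T → B ∈ T

/-- A consistent theory that contains each formula or its negation. -/
structure IsMaxTheory (L T : Set BiForm) : Prop extends IsTheory L T where
  bot_notMem : bot ∉ T
  mem_or : ∀ A, A ∈ T ∨ neg A ∈ T

section Theories

variable {L T : Set BiForm}

theorem IsTheory.taut (hL : IsNormalLogic L) (hT : IsTheory L T) {A : BiForm}
    (hA : IsTautology A) : A ∈ T := hT.subset (hL.taut A hA)

/-- Theories need not be closed under necessitation, so the deduction theorem is available: this set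
is the theory generated by `T` and `A`. -/
theorem IsTheory.adjoin (hL : IsNormalLogic L) (hT : IsTheory L T) (A : BiForm) :
    IsTheory L {B | imp A B ∈ T} where
  subset B hB := hT.mp B _ (hT.taut hL fun v _ h => by simp only [h]; tauto) (hT.subset hB)
  mp B C hBC hB := hT.mp _ _ (hT.mp _ _ (hT.taut hL (A := imp (imp A (imp B C))
    (imp (imp A B) (imp A C))) fun v _ h => by simp only [h]; tauto) hBC) hB

/-- Lindenbaum's lemma. Zorn gives a maximal theory `M` omitting `A`. Adjoining any `B ∉ M` must
produce `A`, so if `B` and `neg B` were both missing, `A` would follow by cases. -/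
theorem IsTheory.exists_isMaxTheory (hL : IsNormalLogic L) (hT : IsTheory L T) {A : BiForm}
    (hA : A ∉ T) : ∃ M, IsMaxTheory L M ∧ T ⊆ M ∧ A ∉ M := by
  obtain ⟨M, hTM, hM⟩ := zorn_subset_nonempty {T | IsTheory L T ∧ A ∉ T} (by
    intro c hc hchain ⟨T₀, hT₀⟩
    refine ⟨⋃₀ c, ⟨⟨fun B hB => ⟨T₀, hT₀, (hc hT₀).1.subset hB⟩, ?_⟩, ?_⟩,
      fun s hs => Set.subset_sUnion_of_mem hs⟩
    · rintro B C ⟨s, hs, hBC⟩ ⟨t, ht, hB⟩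
      rcases hchain.total hs ht with h | h
      · exact ⟨t, ht, (hc ht).1.mp _ _ (h hBC) hB⟩
      · exact ⟨s, hs, (hc hs).1.mp _ _ hBC (h hB)⟩
    · rintro ⟨s, hs, h⟩
      exact (hc hs).2 h) T ⟨hT, hA⟩
  obtain ⟨hMT, hAM⟩ := hM.prop
  have key : ∀ B, B ∉ M → imp B A ∈ M := by
    intro B hB
    by_contra hBA
    refine hB (hM.le_of_ge ⟨hMT.adjoin hL B, hBA⟩ (fun C hC => ?_) ?_)
    · exact hMT.mp C _ (hMT.taut hL fun v _ h => by simp only [h]; tauto) hC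
    · exact hMT.taut hL fun v _ h => by simp only [h]; tauto
  refine ⟨M, ⟨hMT, fun h => hAM ?_, fun B => ?_⟩, hTM, hAM⟩
  · exact hMT.mp bot A (hMT.taut hL fun v hb h => by simp only [h]; tauto) h
  · by_contra! hB
    refine hAM (hMT.mp _ _ (hMT.mp _ _ (hMT.taut hL (A := imp (imp B A)
      (imp (imp (neg B) A) A)) fun v hb h => ?_) (key _ hB.1)) (key _ hB.2))
    simp only [neg, h]; tauto

theorem IsMaxTheory.imp_mem (hL : IsNormalLogic L) (hT : IsMaxTheory L T) {A B : BiForm} :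
    imp A B ∈ T ↔ (A ∈ T → B ∈ T) := by
  refine ⟨hT.mp A B, fun h => ?_⟩
  rcases hT.mem_or A with hA | hA
  · exact hT.mp B _ (hT.taut hL fun v _ h => by simp only [h]; tauto) (h hA)
  · exact hT.mp _ _ (hT.taut hL fun v _ h => by simp only [neg, h]; tauto) hA

theorem IsMaxTheory.neg_mem (hL : IsNormalLogic L) (hT : IsMaxTheory L T) {A : BiForm} :
    neg A ∈ T ↔ A ∉ T := by
  rw [neg, hT.imp_mem hL]
  exact ⟨fun h hA => hT.bot_notMem (h hA), fun h hA => absurd hA h⟩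

theorem IsMaxTheory.conj_mem (hL : IsNormalLogic L) (hT : IsMaxTheory L T) {A B : BiForm} :
    conj A B ∈ T ↔ A ∈ T ∧ B ∈ T := by
  rw [conj, hT.neg_mem hL, hT.imp_mem hL, hT.neg_mem hL]
  tauto

theorem IsMaxTheory.disj_mem (hL : IsNormalLogic L) (hT : IsMaxTheory L T) {A B : BiForm} :
    disj A B ∈ T ↔ A ∈ T ∨ B ∈ T := by
  rw [disj, hT.imp_mem hL, hT.neg_mem hL]
  tauto

theorem IsTheory.unbox (hL : IsNormalLogic L) (hT : IsTheory L T) : IsTheory L {A | box A ∈ T} where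
  subset A hA := hT.subset (hL.nec_box A hA)
  mp A B hAB hA := hT.mp _ _ (hT.mp _ _ (hT.subset (hL.box_imp A B)) hAB) hA

theorem IsTheory.unnbox (hL : IsNormalLogic L) (hT : IsTheory L T) :
    IsTheory L {A | nbox A ∈ T} where
  subset A hA := hT.subset (hL.nec_nbox A hA)
  mp A B hAB hA := hT.mp _ _ (hT.mp _ _ (hT.subset (hL.nbox_imp A B)) hAB) hA

end Theories

/-! ### The canonical frame of `S4DT₀` -/

/-- The maximal theories over `S4DT₀`. -/
abbrev World : Type := {T : Set BiForm // IsMaxTheory S4DT0 T}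

namespace World

/-- The canonical accessibility relation of `□`. -/
def Rel (x y : World) : Prop := ∀ A, box A ∈ x.1 → A ∈ y.1

/-- The canonical accessibility relation of `[≠]`. -/
def NRel (x y : World) : Prop := ∀ A, nbox A ∈ x.1 → A ∈ y.1

variable {x y z : World} {A B : BiForm}

theorem of_mem_logic (h : imp A B ∈ S4DT0) (hA : A ∈ x.1) : B ∈ x.1 :=
  x.2.mp A B (x.2.subset h) hA

theorem neg_mem : neg A ∈ x.1 ↔ A ∉ x.1 := x.2.neg_mem isNormalLogic_S4DT0

theorem conj_mem : conj A B ∈ x.1 ↔ A ∈ x.1 ∧ B ∈ x.1 := x.2.conj_mem isNormalLogic_S4DT0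

theorem disj_mem : disj A B ∈ x.1 ↔ A ∈ x.1 ∨ B ∈ x.1 := x.2.disj_mem isNormalLogic_S4DT0

theorem box_mem : box A ∈ x.1 ↔ ∀ y, Rel x y → A ∈ y.1 := by
  refine ⟨fun h y hy => hy A h, fun h => by_contra fun hA => ?_⟩
  obtain ⟨M, hM, hxM, hAM⟩ := (x.2.unbox isNormalLogic_S4DT0).exists_isMaxTheory
    isNormalLogic_S4DT0 hA
  exact hAM (h ⟨M, hM⟩ fun B hB => hxM hB)

theorem nbox_mem : nbox A ∈ x.1 ↔ ∀ y, NRel x y → A ∈ y.1 := by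
  refine ⟨fun h y hy => hy A h, fun h => by_contra fun hA => ?_⟩
  obtain ⟨M, hM, hxM, hAM⟩ := (x.2.unnbox isNormalLogic_S4DT0).exists_isMaxTheory
    isNormalLogic_S4DT0 hA
  exact hAM (h ⟨M, hM⟩ fun B hB => hxM hB)

theorem ndia_mem : ndia A ∈ x.1 ↔ ∃ y, NRel x y ∧ A ∈ y.1 := by
  simp only [ndia, neg_mem, nbox_mem, not_forall, not_not, exists_prop]

theorem all_mem : all A ∈ x.1 ↔ nbox A ∈ x.1 ∧ A ∈ x.1 := conj_mem

theorem Rel.refl (x : World) : Rel x x := fun A h => of_mem_logic (axT_inst A) h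

theorem Rel.trans (h : Rel x y) (h' : Rel y z) : Rel x z :=
  fun A hA => h' A (h _ (of_mem_logic (axFour_inst A) hA))

theorem NRel.symm (h : NRel x y) : NRel y x := by
  intro A hA
  by_contra hx
  obtain ⟨z, hz, hzA⟩ := ndia_mem.1 (h _ (of_mem_logic (axBD_inst _) (neg_mem.2 hx)))
  exact neg_mem.1 hzA (hz A hA)

theorem exists_mem_notMem (h : x ≠ y) : ∃ A, A ∈ x.1 ∧ A ∉ y.1 := by
  by_contra! hxy
  refine h (Subtype.ext (Set.Subset.antisymm hxy fun A hA => by_contra fun hx => ?_))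
  exact neg_mem.1 (hxy _ (neg_mem.2 hx)) hA

/-- Two distinct worlds unrelated by `NRel` are told apart by a formula that is true
throughout the first world's `[∀]`-cone. -/
theorem exists_all_mem_notMem (h : x ≠ y) (h' : ¬ NRel x y) : ∃ A, all A ∈ x.1 ∧ A ∉ y.1 := by
  obtain ⟨A, hAx, hAy⟩ := exists_mem_notMem h
  simp only [NRel, not_forall] at h'
  obtain ⟨B, hBx, hBy⟩ := h'
  refine ⟨disj A B, ?_, ?_⟩
  · rw [all_mem, nbox_mem, disj_mem]
    exact ⟨fun z hz => disj_mem.2 (Or.inr (hz B hBx)), Or.inl hAx⟩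
  · rw [disj_mem]
    tauto

theorem Rel.eq_or_nrel (h : Rel x y) : x = y ∨ NRel x y := by
  by_contra! hxy
  obtain ⟨A, hx, hy⟩ := exists_all_mem_notMem hxy.1 hxy.2
  exact hy (h A (of_mem_logic (axD_inst A) hx))

theorem NRel.trans_of_ne (h : NRel x y) (h' : NRel y z) (hne : x ≠ z) : NRel x z := by
  by_contra hxz
  obtain ⟨A, hx, hz⟩ := exists_all_mem_notMem hne hxz
  exact hz (h' A (h _ (of_mem_logic (axFourD_inst A) hx)))

/-- A world not `NRel`-related to itself has a name: a formula true at it and false at all its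
`NRel`-successors. -/
theorem exists_name (h : ¬ NRel x x) : ∃ A, A ∈ x.1 ∧ nbox (neg A) ∈ x.1 := by
  simp only [NRel, not_forall] at h
  obtain ⟨A, hA, hxA⟩ := h
  refine ⟨neg A, neg_mem.2 hxA, nbox_mem.2 fun y hy => ?_⟩
  simpa only [neg_mem, not_not] using hy A hA

theorem not_rel_and_rel (hx : ¬ NRel x x) (hy : ¬ NRel y y) (hxy : NRel x y) :
    ¬ (Rel x y ∧ Rel y x) := by
  rintro ⟨hR, hR'⟩
  obtain ⟨p, hp, hp'⟩ := exists_name hx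
  obtain ⟨q, hq, hq'⟩ := exists_name hy
  have := of_mem_logic (axT0_inst p q)
    (conj_mem.2 ⟨conj_mem.2 ⟨hp, hp'⟩, ndia_mem.2 ⟨y, hxy, conj_mem.2 ⟨hq, hq'⟩⟩⟩)
  rcases disj_mem.1 this with h | h
  · exact neg_mem.1 (hR _ h) hq
  · obtain ⟨z, hxz, hz⟩ := ndia_mem.1 h
    obtain ⟨hqz, hpz⟩ := conj_mem.1 hz
    -- The witness `z` must be `y` itself, since the name `q` of `y` fails at every `NRel`-successor
    -- of `y`. But `□¬p` at `y` contradicts `Rel y x`.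
    by_cases hyz : y = z
    · exact neg_mem.1 (hR' _ (hyz ▸ hpz)) hp
    · exact neg_mem.1 (hxy.symm.trans_of_ne hxz hyz _ hq') hqz

/-- The worlds reachable from `w`. -/
def component (w : World) : Set World := {x | w = x ∨ NRel w x}

theorem nrel_of_mem_component {w : World} (hx : x ∈ component w) (hy : y ∈ component w)
    (h : x ≠ y) : NRel x y := by
  rcases hx with rfl | hx
  · exact hy.resolve_left h
  · rcases hy with rfl | hy
    · exact hx.symm
    · exact hx.symm.trans_of_ne hy h

theorem NRel.mem_component {w : World} (h : NRel x y) (hx : x ∈ component w) :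
    y ∈ component w := by
  rcases hx with rfl | hx
  · exact Or.inr h
  · exact or_iff_not_imp_left.2 fun hne => hx.trans_of_ne h hne

theorem Rel.mem_component {w : World} (h : Rel x y) (hx : x ∈ component w) :
    y ∈ component w := by
  rcases h.eq_or_nrel with rfl | h
  · exact hx
  · exact h.mem_component hx

end World

/-! ### The canonical space -/

open World

/-- The points of the canonical space at `w`: infinitely many copies of each world of the component
of `w` that is `[≠]`-accessible from itself, and one copy of every other world. -/
structure Point (w : World) : Type u where
  world : World
  index : ULift.{u} ℕ
  mem : world ∈ component w
  index_eq : ¬ NRel world world → index = 0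

namespace Point

variable {w : World}

theorem exists_world_eq {v : World} (hv : v ∈ component w) : ∃ x : Point.{u} w, x.world = v :=
  ⟨⟨v, 0, hv, fun _ => rfl⟩, rfl⟩

theorem eq_of_world_eq {x y : Point.{u} w} (h : x.world = y.world)
    (hx : ¬ NRel x.world x.world) : x = y := by
  obtain ⟨v, n, hv, hn⟩ := x
  obtain ⟨v', m, hv', hm⟩ := y
  obtain rfl : v = v' := h
  obtain rfl := hn hx
  obtain rfl := hm hx
  rfl

theorem infinite_fibre {v : World} (hv : v ∈ component w) (h : NRel v v) :
    {x : Point.{u} w | x.world = v}.Infinite := by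
  refine Set.infinite_of_injective_forall_mem
    (f := fun n : ℕ => (⟨v, ⟨n⟩, hv, fun h' => absurd h h'⟩ : Point.{u} w)) ?_ fun _ => rfl
  intro n m hnm
  simpa using hnm

/-- A set is open if, along with each point, it contains cofinitely many copies of each accessible
world, and the unique copy of such a world if there is just one. -/
instance : TopologicalSpace (Point.{u} w) where
  IsOpen U := ∀ x ∈ U, ∀ v, World.Rel x.world v →
    {y | y.world = v ∧ y ∉ U}.Finite ∧ (¬ NRel v v → ∀ y, y.world = v → y ∈ U)
  isOpen_univ := by simp
  isOpen_inter s t hs ht x hx v hv := by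
    refine ⟨(((hs x hx.1 v hv).1).union ((ht x hx.2 v hv).1)).subset ?_,
      fun h y hy => ⟨(hs x hx.1 v hv).2 h y hy, (ht x hx.2 v hv).2 h y hy⟩⟩
    rintro y ⟨hy, hyst⟩
    by_cases hys : y ∈ s
    · exact Or.inr ⟨hy, fun hyt => hyst ⟨hys, hyt⟩⟩
    · exact Or.inl ⟨hy, hys⟩
  isOpen_sUnion S hS := by
    rintro x ⟨s, hs, hx⟩ v hv
    exact ⟨((hS s hs x hx v hv).1).subset fun y hy => ⟨hy.1, fun hys => hy.2 ⟨s, hs, hys⟩⟩,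
      fun h y hy => ⟨s, hs, (hS s hs x hx v hv).2 h y hy⟩⟩

theorem isOpen_iff {U : Set (Point.{u} w)} : IsOpen U ↔ ∀ x ∈ U, ∀ v, World.Rel x.world v →
    {y | y.world = v ∧ y ∉ U}.Finite ∧ (¬ NRel v v → ∀ y, y.world = v → y ∈ U) := Iff.rfl

theorem isOpen_cone (v : World) : IsOpen {x : Point.{u} w | World.Rel v x.world} := by
  intro x hx v' hv'
  have h : ∀ y : Point.{u} w, y.world = v' → World.Rel v y.world := by
    rintro y rfl
    exact hx.trans hv'
  refine ⟨Set.Finite.subset Set.finite_empty fun y hy => hy.2 (h y hy.1), fun _ y hy => h y hy⟩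

/-- Deleting one point of a duplicated world costs finitely many copies of that world and nothing
from any other. -/
theorem isOpen_compl_singleton_of_nrel {x : Point.{u} w} (hx : NRel x.world x.world) :
    IsOpen ({x}ᶜ : Set (Point.{u} w)) := by
  rintro - - v -
  refine ⟨(Set.finite_singleton x).subset fun y hy => by simpa using hy.2, ?_⟩
  rintro hv y rfl rfl
  exact hv hx

instance : T0Space (Point.{u} w) := by
  refine ⟨fun x y hxy => by_contra fun hne => ?_⟩
  have hopen (U : Set (Point.{u} w)) (hU : IsOpen U) : x ∈ U ↔ y ∈ U := hxy.mem_open_iff hU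
  by_cases hx : NRel x.world x.world
  · exact (hopen _ (isOpen_compl_singleton_of_nrel hx)).2 (Ne.symm hne) rfl
  by_cases hy : NRel y.world y.world
  · exact (hopen _ (isOpen_compl_singleton_of_nrel hy)).1 hne rfl
  -- Both worlds are unduplicated, hence distinct; topological indistinguishability puts each in the
  -- other's open cone.
  · exact not_rel_and_rel hx hy
      (nrel_of_mem_component x.mem y.mem fun h => hne (eq_of_world_eq h hx))
      ⟨(hopen _ (isOpen_cone x.world)).1 (Rel.refl _),
        (hopen _ (isOpen_cone y.world)).2 (Rel.refl _)⟩

/-- Back condition for `□`: a cofinite subset of an infinite fibre is nonempty, and a single copy is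
required to lie in `U`. -/
theorem exists_mem_world_eq {U : Set (Point.{u} w)} (hU : IsOpen U) {x : Point.{u} w} (hx : x ∈ U)
    {v : World} (hv : World.Rel x.world v) : ∃ y ∈ U, y.world = v := by
  have hvw := hv.mem_component x.mem
  obtain ⟨hfin, hall⟩ := isOpen_iff.1 hU x hx v hv
  by_cases h : NRel v v
  · by_contra! hU'
    exact infinite_fibre hvw h (hfin.subset fun y hy => ⟨hy, fun hyU => hU' y hyU hy⟩)
  · obtain ⟨y, hy⟩ := exists_world_eq.{u} hvw
    exact ⟨y, hall h y hy, hy⟩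

/-- Forth and back conditions for `[≠]`. When `v` is the world of `x` itself, a different copy
exists exactly when the world is duplicated. -/
theorem exists_ne_world_eq_iff {x : Point.{u} w} {v : World} :
    (∃ y, y ≠ x ∧ y.world = v) ↔ NRel x.world v := by
  constructor
  · rintro ⟨y, hyx, rfl⟩
    by_cases h : x.world = y.world
    · rw [← h]
      by_contra hx
      exact hyx (eq_of_world_eq h hx).symm
    · exact nrel_of_mem_component x.mem y.mem h
  · intro h
    have hv := h.mem_component x.mem
    by_cases hxv : x.world = v
    · obtain ⟨y, hy, hyx⟩ := (infinite_fibre hv (hxv ▸ h)).exists_notMem_finite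
        (Set.finite_singleton x)
      exact ⟨y, hyx, hy⟩
    · obtain ⟨y, rfl⟩ := exists_world_eq.{u} hv
      exact ⟨y, fun hyx => hxv (hyx ▸ rfl), rfl⟩

/-- The canonical valuation. -/
def valuation (w : World) (p : ℕ) : Set (Point.{u} w) := {x | var p ∈ x.world.1}

theorem holds_valuation (A : BiForm) (x : Point.{u} w) :
    Holds (valuation w) A x ↔ A ∈ x.world.1 := by
  induction A generalizing x with
  | var p => rfl
  | bot => exact ⟨False.elim, x.world.2.bot_notMem⟩
  | imp A B hA hB =>
    rw [x.world.2.imp_mem isNormalLogic_S4DT0, ← hA, ← hB]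
    rfl
  | box A hA =>
    simp only [Holds, hA, box_mem]
    constructor
    · rintro ⟨U, hU, hx, h⟩ v hv
      obtain ⟨y, hyU, rfl⟩ := exists_mem_world_eq hU hx hv
      exact h y hyU
    · exact fun h => ⟨_, isOpen_cone x.world, Rel.refl _, fun y hy => h _ hy⟩
  | nbox A hA =>
    simp only [Holds, hA, nbox_mem, ← exists_ne_world_eq_iff]
    exact ⟨fun h v ⟨y, hyx, hy⟩ => hy ▸ h y hyx, fun h y hy => h _ ⟨y, hy, rfl⟩⟩

end Point

theorem logicOf_subset_S4DT0 : logicOf {X : TopCat.{u} | T0Space X} ⊆ S4DT0 := by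
  intro A hA
  by_contra hAL
  obtain ⟨M, hM, -, hAM⟩ := (IsTheory.mk subset_rfl isNormalLogic_S4DT0.mp).exists_isMaxTheory
    isNormalLogic_S4DT0 hAL
  -- Worlds live in universe 0; the `ULift` in the index of `Point` places the countermodel in
  -- universe `u`.
  obtain ⟨x, hx⟩ := Point.exists_world_eq.{u} (w := ⟨M, hM⟩) (Or.inl rfl)
  have h := (Point.holds_valuation A x).1 (hA (TopCat.of (Point ⟨M, hM⟩))
    (inferInstanceAs (T0Space (Point _))) (Point.valuation _) x)
  rw [hx] at h
  exact hAM h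

end BiForm

theorem theorem7p2 :
    BiForm.IsCompleteFor BiForm.S4DT0 {X : TopCat.{u} | T0Space X} := by
  exact Set.Subset.antisymm BiForm.logicOf_subset_S4DT0 BiForm.S4DT0_subset_logicOf
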